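/- Lemma (large sample distribution of the least squares estimator, homoskedastic case). Let $p\ge 0$ be an integer, $\beta\in\mathbb R^p$, $\sigma\in\mathbb R$, and let $(n_m)_{m}$ be a sequence of sample sizes. For each $m$ let $X_m$ be a (fixed or random) $n_m\times p$ design matrix with rows $x_{m1}^\top,\dots,x_{mn_m}^\top$, let $\varepsilon_m=(\varepsilon_{m1},\dots,\varepsilon_{mn_m})^\top$ be a random noise vector independent of $X_m$ (this holds automatically if $X_m$ is fixed), and let $y_m=X_m\beta+\varepsilon_m$, everything being defined on one probability space. Assume: (i) for each $m$ the variables $\varepsilon_{m1},\dots,\varepsilon_{mn_m}$ are independent, and all $\varepsilon_{mi}$ (for all $m$ and $i$) have the same distribution; (ii) for all sufficiently large $m$, $X_m$ has full rank $p$ almost surely; (iii) the $\varepsilon_{mi}$ are square integrable, $\mathbb E[\varepsilon_m]=0$ and $\operatorname{Cov}[\varepsilon_m]=\sigma^2 I_{n_m}$; (iv) $\max_{1\le i\le n_m} x_{mi}^\top (X_m^\top X_m)^{-1}x_{mi}\to 0$ in probability as $m\to\infty$ (for fixed designs: in the ordinary sense). Then the least squares estimator $\hat\beta_m=(X_m^\top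 X_m)^{-1}X_m^\top y_m$ satisfies $$(X_m^\top X_m)^{1/2}(\hat\beta_m-\beta)\ \xrightarrow{\ d\ }\ N_p(0,\sigma^2 I_p)\qquad (m\to\infty),$$ where $(X_m^\top X_m)^{1/2}$ is the positive semidefinite square root. -/

import Mathlib

open MeasureTheory ProbabilityTheory Filter Topology Matrix
open scoped MatrixOrder

/-- The ordinary least squares estimator `(XᵀX)⁻¹ Xᵀ y` for an `n × p` design matrix `X` and a
response vector `y`. -/
noncomputable def olsEstimator {n p : ℕ} (X : Matrix (Fin n) (Fin p) ℝ) (y : Fin n → ℝ) :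
    Fin p → ℝ :=
  (Xᵀ * X)⁻¹ *ᵥ (Xᵀ *ᵥ y)

/-- The leverage `xᵢᵀ (XᵀX)⁻¹ xᵢ` of the `i`-th observation, `xᵢ` being the `i`-th row of `X`. -/
noncomputable def leverage {n p : ℕ} (X : Matrix (Fin n) (Fin p) ℝ) (i : Fin n) : ℝ :=
  X i ⬝ᵥ ((Xᵀ * X)⁻¹ *ᵥ X i)

/-- The largest leverage `max_i xᵢᵀ (XᵀX)⁻¹ xᵢ` (equal to `0` when there are no observations). -/
noncomputable def maxLeverage {n p : ℕ} (X : Matrix (Fin n) (Fin p) ℝ) : ℝ :=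
  ⨆ i : Fin n, leverage X i

/-- The standardized estimation error `(XᵀX)^{1/2} (β̂ - β)`, where `(XᵀX)^{1/2}` is the positive
semidefinite square root of the Gram matrix `XᵀX`. -/
noncomputable def standardizedError {n p : ℕ} (X : Matrix (Fin n) (Fin p) ℝ) (y : Fin n → ℝ)
    (β : Fin p → ℝ) : EuclideanSpace ℝ (Fin p) :=
  WithLp.toLp 2 (CFC.sqrt (Xᵀ * X) *ᵥ (olsEstimator X y - β))

/-! Write S for the square root of the Gram matrix. At full rank the standardized error is S⁻¹Xᵀε,
so its inner product with t is ∑ wᵢ εᵢ with w = X S⁻¹ t. Here ∑ wᵢ² = ‖t‖² (`sum_sq_designWeight`)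
and wᵢ² is at most the maximal leverage times ‖t‖² (`sq_designWeight_le`). Given the design, the
characteristic function at t is ∏ φ(wᵢ), with φ that of the common noise law. Small leverage puts
every wᵢ near 0, where φ agrees with the Gaussian one to second order, so the product is within
η‖t‖² of exp(-σ²‖t‖²/2) (`exists_norm_prod_charFun_sub_exp_le`). This target does not depend on the
design, so averaging over X costs only the probability of large leverage, and Lévy's continuity
theorem concludes. -/

/-! ### Products of characteristic functions at small weights. -/

/-- Second order Taylor expansion at `0` of the characteristic function of a centered law with
second moment `v`. -/
lemma charFun_sub_isLittleO_sq {μ : Measure ℝ} [IsProbabilityMeasure μ] {v : ℝ}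
    (hL2 : MemLp id 2 μ) (h0 : ∫ x, x ∂μ = 0) (h2 : ∫ x, x ^ 2 ∂μ = v) :
    (fun t : ℝ ↦ charFun μ t - (1 - v * t ^ 2 / 2)) =o[𝓝 0] fun t : ℝ ↦ t ^ 2 := by
  have key (t : ℝ) : taylorWithinEval (charFun μ) 2 Set.univ 0 t = 1 - v * t ^ 2 / 2 := by
    have := taylorWithinEval_charFun_two_zero (P := μ) (X := id) aemeasurable_id
      (by simpa using hL2) t
    simp only [Measure.map_id, id_eq, Pi.pow_apply, h0, h2] at this
    simpa using this
  have := taylor_isLittleO_univ (f := charFun μ) (x₀ := 0) (n := 2) (contDiff_charFun (by simpa))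
  simp_rw [key] at this
  simpa using this

lemma charFun_sub_charFun_isLittleO_sq {μ ν : Measure ℝ} [IsProbabilityMeasure μ]
    [IsProbabilityMeasure ν] (hμ : MemLp id 2 μ) (hν : MemLp id 2 ν)
    (hμ0 : ∫ x, x ∂μ = 0) (hν0 : ∫ x, x ∂ν = 0) (h2 : ∫ x, x ^ 2 ∂μ = ∫ x, x ^ 2 ∂ν) :
    (fun t : ℝ ↦ charFun μ t - charFun ν t) =o[𝓝 0] fun t : ℝ ↦ t ^ 2 := by
  simpa using (charFun_sub_isLittleO_sq hμ hμ0 h2).sub (charFun_sub_isLittleO_sq hν hν0 rfl)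

/-- Factors are exchanged one at a time, the others having norm at most 1; this avoids complex
logarithms. -/
lemma norm_prod_sub_prod_le_sum {ι 𝕜 : Type*} [NormedField 𝕜] (s : Finset ι) {f g : ι → 𝕜}
    (hf : ∀ i ∈ s, ‖f i‖ ≤ 1) (hg : ∀ i ∈ s, ‖g i‖ ≤ 1) :
    ‖∏ i ∈ s, f i - ∏ i ∈ s, g i‖ ≤ ∑ i ∈ s, ‖f i - g i‖ := by
  classical
  induction s using Finset.induction with
  | empty => simp
  | insert j s hj ih =>
    simp only [Finset.forall_mem_insert] at hf hg
    rw [Finset.prod_insert hj, Finset.prod_insert hj, Finset.sum_insert hj]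
    have hp : ‖∏ i ∈ s, f i‖ ≤ 1 := by
      rw [norm_prod]
      exact Finset.prod_le_one (fun _ _ ↦ norm_nonneg _) hf.2
    calc ‖f j * ∏ i ∈ s, f i - g j * ∏ i ∈ s, g i‖
        = ‖(f j - g j) * ∏ i ∈ s, f i + g j * (∏ i ∈ s, f i - ∏ i ∈ s, g i)‖ := by ring_nf
      _ ≤ ‖f j - g j‖ * ‖∏ i ∈ s, f i‖ + ‖g j‖ * ‖∏ i ∈ s, f i - ∏ i ∈ s, g i‖ := by
        simpa using norm_add_le ((f j - g j) * ∏ i ∈ s, f i) (g j * (∏ i ∈ s, f i - ∏ i ∈ s, g i))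
      _ ≤ ‖f j - g j‖ * 1 + 1 * ∑ i ∈ s, ‖f i - g i‖ := by
        gcongr
        exacts [hg.1, ih hf.2 hg.2]
      _ = _ := by ring

/-- A product of characteristic functions of a centered law with variance `σ ^ 2`, evaluated at
uniformly small weights, is close to the Gaussian characteristic function. -/
lemma exists_norm_prod_charFun_sub_exp_le {μ : Measure ℝ} [IsProbabilityMeasure μ] {σ : ℝ}
    (hL2 : MemLp id 2 μ) (h0 : ∫ x, x ∂μ = 0) (h2 : ∫ x, x ^ 2 ∂μ = σ ^ 2) {η : ℝ} (hη : 0 < η) :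
    ∃ δ > 0, ∀ (n : ℕ) (a : Fin n → ℝ), (∀ i, a i ^ 2 < δ) →
      ‖∏ i, charFun μ (a i) - Complex.exp (-(σ ^ 2 * ∑ i, a i ^ 2 : ℝ) / 2)‖ ≤
        η * ∑ i, a i ^ 2 := by
  -- The exponential is itself a product of characteristic functions of `ν`, so the products are
  -- compared factor by factor.
  set ν : Measure ℝ := gaussianReal 0 (σ ^ 2).toNNReal with hν
  have : IsProbabilityMeasure ν := by rw [hν]; infer_instance
  have hν0 : ∫ x, x ∂ν = 0 := integral_id_gaussianReal
  have hνL2 : MemLp id 2 ν := memLp_id_gaussianReal 2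
  have hν2 : ∫ x, x ^ 2 ∂ν = σ ^ 2 := by
    have := variance_of_integral_eq_zero (μ := ν) (X := id) aemeasurable_id hν0
    rw [hν, variance_id_gaussianReal, Real.coe_toNNReal _ (sq_nonneg σ), ← hν] at this
    simpa using this.symm
  have hcf (t : ℝ) : charFun ν t = Complex.exp (-(σ ^ 2 * t ^ 2 : ℝ) / 2) := by
    rw [hν, charFun_gaussianReal, Real.coe_toNNReal _ (sq_nonneg σ)]
    congr 1
    push_cast
    ring
  have ho := charFun_sub_charFun_isLittleO_sq hL2 hνL2 h0 hν0 (h2.trans hν2.symm)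
  obtain ⟨r, hr, hball⟩ := Metric.eventually_nhds_iff.1 (ho.def hη)
  -- The radius comes from one fixed law, hence serves every n and every weight vector.
  refine ⟨r ^ 2, by positivity, fun n a ha ↦ ?_⟩
  have hexp : Complex.exp (-(σ ^ 2 * ∑ i, a i ^ 2 : ℝ) / 2) = ∏ i, charFun ν (a i) := by
    simp_rw [hcf, ← Complex.exp_sum]
    congr 1
    push_cast
    rw [← Finset.sum_div, Finset.mul_sum, ← Finset.sum_neg_distrib]
  rw [hexp, Finset.mul_sum]
  refine (norm_prod_sub_prod_le_sum _ (fun _ _ ↦ norm_charFun_le_one _)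
    (fun _ _ ↦ norm_charFun_le_one _)).trans (Finset.sum_le_sum fun i _ ↦ ?_)
  have := hball (y := a i) (by simpa using abs_lt_of_sq_lt_sq (ha i) hr.le)
  simpa using this

/-! ### Linear algebra of the design matrix. -/

section Design

variable {n p : ℕ} {X : Matrix (Fin n) (Fin p) ℝ}

lemma gramSqrt_mul_self (X : Matrix (Fin n) (Fin p) ℝ) :
    CFC.sqrt (Xᵀ * X) * CFC.sqrt (Xᵀ * X) = Xᵀ * X :=
  CFC.sqrt_mul_sqrt_self _ (Matrix.nonneg_iff_posSemidef.2 (by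
    simpa using posSemidef_conjTranspose_mul_self X))

lemma gramSqrt_transpose (X : Matrix (Fin n) (Fin p) ℝ) :
    (CFC.sqrt (Xᵀ * X))ᵀ = CFC.sqrt (Xᵀ * X) := by
  simpa [IsHermitian] using
    (Matrix.nonneg_iff_posSemidef.1 (CFC.sqrt_nonneg (Xᵀ * X))).isHermitian

lemma isUnit_gram_of_rank_eq (hX : X.rank = p) : IsUnit (Xᵀ * X) := by
  rw [← mulVec_surjective_iff_isUnit, ← coe_mulVecLin, ← LinearMap.range_eq_top]
  refine Submodule.eq_top_of_finrank_eq ?_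
  rw [← Matrix.rank, rank_transpose_mul_self, hX, Module.finrank_fin_fun]

lemma isUnit_gramSqrt_of_rank_eq (hX : X.rank = p) : IsUnit (CFC.sqrt (Xᵀ * X)) := by
  have := isUnit_gram_of_rank_eq hX
  rw [← gramSqrt_mul_self, isUnit_iff_isUnit_det, det_mul, IsUnit.mul_iff] at this
  exact (isUnit_iff_isUnit_det _).2 this.1

lemma gram_inv_eq (X : Matrix (Fin n) (Fin p) ℝ) :
    (Xᵀ * X)⁻¹ = (CFC.sqrt (Xᵀ * X))⁻¹ * (CFC.sqrt (Xᵀ * X))⁻¹ := by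
  conv_lhs => rw [← gramSqrt_mul_self, Matrix.mul_inv_rev]

lemma gramSqrt_inv_transpose (X : Matrix (Fin n) (Fin p) ℝ) :
    ((CFC.sqrt (Xᵀ * X))⁻¹)ᵀ = (CFC.sqrt (Xᵀ * X))⁻¹ := by
  rw [transpose_nonsing_inv, gramSqrt_transpose]

lemma standardizedError_eq (hX : X.rank = p) (β : Fin p → ℝ) (e : Fin n → ℝ) :
    standardizedError X (X *ᵥ β + e) β =
      WithLp.toLp 2 ((CFC.sqrt (Xᵀ * X))⁻¹ *ᵥ (Xᵀ *ᵥ e)) := by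
  have hG := (isUnit_iff_isUnit_det _).1 (isUnit_gram_of_rank_eq hX)
  have hS := (isUnit_iff_isUnit_det _).1 (isUnit_gramSqrt_of_rank_eq hX)
  have : olsEstimator X (X *ᵥ β + e) - β = (Xᵀ * X)⁻¹ *ᵥ (Xᵀ *ᵥ e) := by
    rw [olsEstimator, mulVec_add, mulVec_add, mulVec_mulVec _ Xᵀ X, mulVec_mulVec,
      nonsing_inv_mul _ hG, one_mulVec, add_sub_cancel_left]
  rw [standardizedError, this, gram_inv_eq, mulVec_mulVec, ← mul_assoc, mul_nonsing_inv _ hS,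
    one_mul]

/-- The coefficients of the noise variables in the component of the standardized error in
direction `t`. -/
noncomputable def designWeight (X : Matrix (Fin n) (Fin p) ℝ) (t : Fin p → ℝ) : Fin n → ℝ :=
  X *ᵥ ((CFC.sqrt (Xᵀ * X))⁻¹ *ᵥ t)

lemma inner_standardizedError (hX : X.rank = p) (β : Fin p → ℝ) (e : Fin n → ℝ)
    (t : EuclideanSpace ℝ (Fin p)) :
    inner ℝ (standardizedError X (X *ᵥ β + e) β) t = e ⬝ᵥ designWeight X t := by
  rw [standardizedError_eq hX, EuclideanSpace.inner_eq_star_dotProduct, star_trivial,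
    dotProduct_mulVec, ← mulVec_transpose, gramSqrt_inv_transpose, dotProduct_mulVec,
    vecMul_transpose, dotProduct_comm, designWeight]

/-- X S⁻¹ has orthonormal columns, because S⁻¹ (XᵀX) S⁻¹ = 1. -/
lemma sum_sq_designWeight (hX : X.rank = p) (t : EuclideanSpace ℝ (Fin p)) :
    ∑ i, designWeight X t i ^ 2 = ‖t‖ ^ 2 := by
  have hS := (isUnit_iff_isUnit_det _).1 (isUnit_gramSqrt_of_rank_eq hX)
  have h1 : ∑ i, designWeight X t i ^ 2 = designWeight X t ⬝ᵥ designWeight X t := by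
    simp [dotProduct, sq]
  have h2 : ‖t‖ ^ 2 = t.ofLp ⬝ᵥ t.ofLp := by
    simp [EuclideanSpace.real_norm_sq_eq, dotProduct, ← sq]
  have h3 : CFC.sqrt (Xᵀ * X) *ᵥ ((CFC.sqrt (Xᵀ * X))⁻¹ *ᵥ t.ofLp) = t.ofLp := by
    rw [mulVec_mulVec, mul_nonsing_inv _ hS, one_mulVec]
  rw [h1, h2, designWeight]
  generalize (CFC.sqrt (Xᵀ * X))⁻¹ *ᵥ t.ofLp = w at h3
  rw [dotProduct_mulVec, ← mulVec_transpose, mulVec_mulVec, ← gramSqrt_mul_self, ← mulVec_mulVec,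
    h3, ← gramSqrt_transpose, mulVec_transpose, ← dotProduct_mulVec, h3]

/-- Cauchy–Schwarz for u = S⁻¹xᵢ, whose squared norm is the leverage. No rank condition is needed:
`gram_inv_eq` also holds for the default inverse 0. -/
lemma sq_designWeight_le (X : Matrix (Fin n) (Fin p) ℝ) (t : EuclideanSpace ℝ (Fin p)) (i : Fin n) :
    designWeight X t i ^ 2 ≤ maxLeverage X * ‖t‖ ^ 2 := by
  set u : EuclideanSpace ℝ (Fin p) := WithLp.toLp 2 ((CFC.sqrt (Xᵀ * X))⁻¹ *ᵥ X i) with hu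
  have h1 : designWeight X t i = inner ℝ u t := by
    rw [EuclideanSpace.inner_eq_star_dotProduct, star_trivial, hu, dotProduct_mulVec,
      ← mulVec_transpose, gramSqrt_inv_transpose, dotProduct_comm]
    rfl
  have h2 : ‖u‖ ^ 2 = leverage X i := by
    rw [EuclideanSpace.real_norm_sq_eq, leverage, gram_inv_eq, ← mulVec_mulVec, dotProduct_mulVec,
      ← mulVec_transpose, gramSqrt_inv_transpose]
    simp [hu, dotProduct, sq]
  have h3 : leverage X i ≤ maxLeverage X := le_ciSup (Set.finite_range _).bddAbove i
  calc designWeight X t i ^ 2 = |inner ℝ u t| ^ 2 := by rw [h1, sq_abs]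
    _ ≤ (‖u‖ * ‖t‖) ^ 2 := by gcongr; exact abs_real_inner_le_norm u t
    _ ≤ _ := by rw [mul_pow, h2]; gcongr

end Design

/-! ### Measurability in the design and the noise. -/

section Measurability

variable {n p : ℕ}

lemma continuous_gramSqrt :
    Continuous fun X : Matrix (Fin n) (Fin p) ℝ ↦ CFC.sqrt (Xᵀ * X) := by
  open scoped Matrix.Norms.L2Operator in
  exact (CFC.continuousOn_sqrt (A := Matrix (Fin p) (Fin p) ℝ)).comp_continuous (by fun_prop)
    fun X ↦ Matrix.nonneg_iff_posSemidef.2 (by simpa using posSemidef_conjTranspose_mul_self X)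

lemma measurable_mulVec_apply {α ι κ : Type*} [MeasurableSpace α] [Fintype κ]
    {A : α → Matrix ι κ ℝ} {v : α → κ → ℝ} (hA : ∀ i j, Measurable fun a ↦ A a i j)
    (hv : ∀ j, Measurable fun a ↦ v a j) (i : ι) : Measurable fun a ↦ (A a *ᵥ v a) i := by
  simp only [mulVec, dotProduct]
  fun_prop

/-- The inverse is discontinuous at singular Gram matrices, but adjugate and determinant are
polynomial and real inversion is measurable. -/
lemma measurable_gram_inv_apply (i j : Fin p) :
    Measurable fun X : Fin n → Fin p → ℝ ↦ ((Matrix.of X)ᵀ * Matrix.of X)⁻¹ i j := by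
  have : Continuous fun X : Fin n → Fin p → ℝ ↦ Matrix.of X := continuous_id
  simp_rw [inv_def, Matrix.smul_apply, Ring.inverse_eq_inv', smul_eq_mul]
  refine Measurable.mul (Continuous.measurable ?_).inv (Continuous.measurable ?_)
  · fun_prop
  · exact Continuous.matrix_elem (by fun_prop) i j

lemma measurable_gramSqrt_apply (i j : Fin p) :
    Measurable fun X : Fin n → Fin p → ℝ ↦ CFC.sqrt ((Matrix.of X)ᵀ * Matrix.of X) i j := by
  have h : Continuous fun X : Fin n → Fin p → ℝ ↦ CFC.sqrt ((Matrix.of X)ᵀ * Matrix.of X) :=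
    continuous_gramSqrt.comp (continuous_id : Continuous fun X : Fin n → Fin p → ℝ ↦ Matrix.of X)
  exact (h.matrix_elem i j).measurable

lemma measurableSet_rank_eq :
    MeasurableSet {X : Fin n → Fin p → ℝ | (Matrix.of X).rank = p} := by
  have hiff (X : Matrix (Fin n) (Fin p) ℝ) : X.rank = p ↔ (Xᵀ * X).det ≠ 0 := by
    refine ⟨fun h ↦ ((isUnit_iff_isUnit_det _).1 (isUnit_gram_of_rank_eq h)).ne_zero, fun h ↦ ?_⟩
    rw [← rank_transpose_mul_self, rank_of_isUnit _ ((isUnit_iff_isUnit_det _).2 h.isUnit),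
      Fintype.card_fin]
  have hof : Continuous fun X : Fin n → Fin p → ℝ ↦ Matrix.of X := continuous_id
  have hdet : Continuous fun X : Fin n → Fin p → ℝ ↦ ((Matrix.of X)ᵀ * Matrix.of X).det := by
    fun_prop
  simp_rw [hiff]
  exact (isOpen_ne_fun hdet continuous_const).measurableSet

lemma measurable_maxLeverage :
    Measurable fun X : Fin n → Fin p → ℝ ↦ maxLeverage (Matrix.of X) := by
  have happly (i : Fin n) (j : Fin p) : Measurable fun X : Fin n → Fin p → ℝ ↦ X i j :=
    (measurable_pi_apply j).comp (measurable_pi_apply i)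
  refine Measurable.iSup fun i ↦ ?_
  simp only [leverage, dotProduct]
  exact Finset.measurable_fun_sum _ fun j _ ↦ (happly i j).mul
    (measurable_mulVec_apply measurable_gram_inv_apply (happly i) j)

lemma measurable_standardizedError (β : Fin p → ℝ) :
    Measurable fun z : (Fin n → Fin p → ℝ) × (Fin n → ℝ) ↦
      standardizedError (Matrix.of z.1) (Matrix.of z.1 *ᵥ β + z.2) β := by
  have hx (i : Fin n) (j : Fin p) :
      Measurable fun z : (Fin n → Fin p → ℝ) × (Fin n → ℝ) ↦ z.1 i j :=
    (measurable_pi_apply j).comp ((measurable_pi_apply i).comp measurable_fst)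
  have he (i : Fin n) : Measurable fun z : (Fin n → Fin p → ℝ) × (Fin n → ℝ) ↦ z.2 i :=
    (measurable_pi_apply i).comp measurable_snd
  refine (WithLp.measurable_toLp 2 _).comp (measurable_pi_lambda _ fun i ↦ ?_)
  refine measurable_mulVec_apply (fun i j ↦ (measurable_gramSqrt_apply i j).comp measurable_fst)
    (fun j ↦ Measurable.sub_const ?_ _) i
  refine measurable_mulVec_apply (fun i j ↦ (measurable_gram_inv_apply i j).comp measurable_fst)
    (measurable_mulVec_apply (fun i j ↦ hx j i) fun l ↦ Measurable.add ?_ (he l)) j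
  exact measurable_mulVec_apply hx (v := fun _ ↦ β) (fun _ ↦ measurable_const) l

end Measurability

/-! ### Averaging over the design, and the limit theorem. -/

/-- Conditionally on a full rank design, the characteristic function of the standardized error is
a product of characteristic functions of the noise law. -/
lemma integral_exp_inner_standardizedError {n p : ℕ} {X : Matrix (Fin n) (Fin p) ℝ}
    (hX : X.rank = p) (β : Fin p → ℝ) (μ : Measure ℝ) [IsProbabilityMeasure μ]
    (t : EuclideanSpace ℝ (Fin p)) :
    ∫ e, Complex.exp (inner ℝ (standardizedError X (X *ᵥ β + e) β) t * Complex.I)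
      ∂(Measure.pi fun _ : Fin n ↦ μ) = ∏ i, charFun μ (designWeight X t i) := by
  rw [← charFun_pi (t := WithLp.toLp 2 (designWeight X t)), charFun_apply,
    ← MeasurableEquiv.coe_toLp, integral_map_equiv]
  simp_rw [inner_standardizedError hX, MeasurableEquiv.coe_toLp,
    EuclideanSpace.inner_eq_star_dotProduct, star_trivial, dotProduct_comm]

lemma norm_integral_sub_le_of_norm_sub_le {α : Type*} [MeasurableSpace α] {ν : Measure α}
    [IsProbabilityMeasure ν] {F : α → ℂ} (hF : Integrable F ν) (c : ℂ) {B : Set α}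
    (hB : MeasurableSet B) {η C : ℝ} (hη : 0 ≤ η) (hC : ∀ᵐ x ∂ν, ‖F x - c‖ ≤ C)
    (h : ∀ᵐ x ∂ν, x ∉ B → ‖F x - c‖ ≤ η) :
    ‖∫ x, F x ∂ν - c‖ ≤ η + C * ν.real B := by
  have h1 : ∫ x, F x ∂ν - c = ∫ x, (F x - c) ∂ν := by
    rw [integral_sub hF (integrable_const c)]
    simp
  have hint : Integrable (fun x ↦ η + B.indicator (fun _ ↦ C) x) ν :=
    (integrable_const η).add ((integrable_const C).indicator hB)
  calc ‖∫ x, F x ∂ν - c‖ ≤ ∫ x, (η + B.indicator (fun _ ↦ C) x) ∂ν := by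
        rw [h1]
        refine norm_integral_le_of_norm_le hint ?_
        filter_upwards [hC, h] with x hx hx'
        by_cases hxB : x ∈ B
        · simpa [hxB] using by linarith
        · simpa [hxB] using hx' hxB
    _ = η + C * ν.real B := by
        rw [integral_add (integrable_const η) ((integrable_const C).indicator hB),
          integral_indicator_const _ hB]
        simp [mul_comm]

/-- The law of the standardized error has a characteristic function close to the Gaussian one as
soon as the maximal leverage is small with large probability. -/
lemma norm_charFun_standardizedError_sub_le {n p : ℕ} (β : Fin p → ℝ) {σ η δ : ℝ}
    (μ : Measure ℝ) [IsProbabilityMeasure μ] (ν : Measure (Fin n → Fin p → ℝ))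
    [IsProbabilityMeasure ν] (hrank : ∀ᵐ X ∂ν, (Matrix.of X).rank = p)
    (t : EuclideanSpace ℝ (Fin p)) (hη : 0 ≤ η)
    (hδ : ∀ a : Fin n → ℝ, (∀ i, a i ^ 2 < δ) →
      ‖∏ i, charFun μ (a i) - Complex.exp (-(σ ^ 2 * ∑ i, a i ^ 2 : ℝ) / 2)‖ ≤
        η * ∑ i, a i ^ 2) :
    ‖charFun ((ν.prod (Measure.pi fun _ ↦ μ)).map
        fun z ↦ standardizedError (Matrix.of z.1) (Matrix.of z.1 *ᵥ β + z.2) β) t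
      - Complex.exp (-(σ ^ 2 * ‖t‖ ^ 2 : ℝ) / 2)‖ ≤
      η * ‖t‖ ^ 2 + 2 * ν.real {X | δ ≤ maxLeverage (Matrix.of X) * ‖t‖ ^ 2} := by
  have hmeas := measurable_standardizedError (n := n) β
  have hint : Integrable (fun z : (Fin n → Fin p → ℝ) × (Fin n → ℝ) ↦ Complex.exp (inner ℝ
      (standardizedError (Matrix.of z.1) (Matrix.of z.1 *ᵥ β + z.2) β) t * Complex.I))
      (ν.prod (Measure.pi fun _ ↦ μ)) :=
    Integrable.of_bound (Measurable.aestronglyMeasurable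
      (Complex.measurable_exp.comp ((Complex.measurable_ofReal.comp
        (hmeas.inner_const (c := t))).mul_const _))) 1 (by simp [Complex.norm_exp_ofReal_mul_I])
  rw [charFun_apply, integral_map hmeas.aemeasurable (by fun_prop), integral_prod _ hint]
  have hprod : ∀ᵐ X ∂ν, ∫ e, Complex.exp (inner ℝ
      (standardizedError (Matrix.of X) (Matrix.of X *ᵥ β + e) β) t * Complex.I)
      ∂(Measure.pi fun _ : Fin n ↦ μ) = ∏ i, charFun μ (designWeight (Matrix.of X) t i) :=
    hrank.mono fun X hX ↦ integral_exp_inner_standardizedError hX β μ t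
  -- The exceptional set is that of large leverage; there the trivial bound 2 holds, both terms
  -- having norm at most 1.
  refine norm_integral_sub_le_of_norm_sub_le hint.integral_prod_left _
    (measurableSet_le measurable_const (measurable_maxLeverage.mul_const _)) (by positivity) ?_ ?_
  · filter_upwards [hprod] with X hX
    rw [hX]
    refine (norm_sub_le _ _).trans ?_
    have h1 : ‖∏ i, charFun μ (designWeight (Matrix.of X) t i)‖ ≤ 1 := by
      rw [norm_prod]
      exact Finset.prod_le_one (fun _ _ ↦ norm_nonneg _) fun _ _ ↦ norm_charFun_le_one _
    have h2 : ‖Complex.exp (-(σ ^ 2 * ‖t‖ ^ 2 : ℝ) / 2)‖ ≤ 1 := by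
      rw [Complex.norm_exp, Real.exp_le_one_iff]
      norm_cast
      have : 0 ≤ σ ^ 2 * ‖t‖ ^ 2 := by positivity
      linarith
    linarith
  · filter_upwards [hprod, hrank] with X hX hr hXB
    rw [hX, ← sum_sq_designWeight hr]
    exact hδ _ fun i ↦ (sq_designWeight_le _ t i).trans_lt (not_le.1 hXB)

/-- Large sample distribution of the least squares estimator. The rows `x m ω i` of the `m`-th
design matrix may be random, but the design is independent of the noise; a fixed design is the case
where `x m` does not depend on `ω`. The noise variables are i.i.d. within each sample, with a law
that is the same for all samples. -/
theorem mainTheorem8 {Ω : Type*} [MeasurableSpace Ω] (P : Measure Ω) [IsProbabilityMeasure P]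
    (p : ℕ) (n : ℕ → ℕ) (β : Fin p → ℝ) (σ : ℝ)
    (x : (m : ℕ) → Ω → Fin (n m) → Fin p → ℝ)
    (y ε : (m : ℕ) → Ω → Fin (n m) → ℝ)
    (hmodel : ∀ m ω, y m ω = Matrix.of (x m ω) *ᵥ β + ε m ω)
    (hx_meas : ∀ m, Measurable (x m))
    (hindep_design : ∀ m, IndepFun (x m) (ε m) P)
    (hindep : ∀ m, iIndepFun (fun (i : Fin (n m)) (ω : Ω) => ε m ω i) P)
    (hident : ∀ (m m' : ℕ) (i : Fin (n m)) (i' : Fin (n m')),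
      IdentDistrib (fun ω => ε m ω i) (fun ω => ε m' ω i') P P)
    (hrank : ∀ᶠ m in atTop, ∀ᵐ ω ∂P, (Matrix.of (x m ω)).rank = p)
    (hL2 : ∀ (m : ℕ) (i : Fin (n m)), MemLp (fun ω => ε m ω i) 2 P)
    (hmean : ∀ (m : ℕ) (i : Fin (n m)), ∫ ω, ε m ω i ∂P = 0)
    (hcov : ∀ (m : ℕ) (i j : Fin (n m)), cov[fun ω => ε m ω i, fun ω => ε m ω j; P] =
      (σ ^ 2 • (1 : Matrix (Fin (n m)) (Fin (n m)) ℝ)) i j)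
    (hlev : TendstoInMeasure P (fun m ω => maxLeverage (Matrix.of (x m ω))) atTop (fun _ => 0)) :
    TendstoInDistribution
      (fun m ω => standardizedError (Matrix.of (x m ω)) (y m ω) β) atTop
      (id : EuclideanSpace ℝ (Fin p) → EuclideanSpace ℝ (Fin p)) (fun _ => P)
      (multivariateGaussian 0 (σ ^ 2 • (1 : Matrix (Fin p) (Fin p) ℝ))) := by
  have hε (m : ℕ) (i : Fin (n m)) : AEMeasurable (fun ω ↦ ε m ω i) P :=
    (hL2 m i).aestronglyMeasurable.aemeasurable
  have hεm (m : ℕ) : AEMeasurable (ε m) P := aemeasurable_pi_lambda _ (hε m)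
  obtain ⟨μ, hμ, hμL2, hμ0, hμ2, hμε⟩ : ∃ μ : Measure ℝ, IsProbabilityMeasure μ ∧ MemLp id 2 μ ∧
      ∫ s, s ∂μ = 0 ∧ ∫ s, s ^ 2 ∂μ = σ ^ 2 ∧ ∀ m i, P.map (fun ω ↦ ε m ω i) = μ := by
    by_cases hne : ∃ m, Nonempty (Fin (n m))
    · obtain ⟨m₀, ⟨i₀⟩⟩ := hne
      refine ⟨P.map fun ω ↦ ε m₀ ω i₀, Measure.isProbabilityMeasure_map (hε m₀ i₀), ?_, ?_, ?_,
        fun m i ↦ (hident m m₀ i i₀).map_eq⟩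
      · exact (memLp_map_measure_iff (by fun_prop) (hε m₀ i₀)).2 (hL2 m₀ i₀)
      · rw [integral_map (hε m₀ i₀) (by fun_prop), hmean]
      · rw [integral_map (hε m₀ i₀) (by fun_prop),
          ← variance_of_integral_eq_zero (hε m₀ i₀) (hmean m₀ i₀), ← covariance_self (hε m₀ i₀),
          hcov]
        simp
    -- With no observations at all, any law with the right moments will do.
    · refine ⟨gaussianReal 0 (σ ^ 2).toNNReal, inferInstance, memLp_id_gaussianReal 2,
        integral_id_gaussianReal, ?_, fun m i ↦ (hne ⟨m, ⟨i⟩⟩).elim⟩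
      have := variance_of_integral_eq_zero (μ := gaussianReal 0 (σ ^ 2).toNNReal) (X := id)
        aemeasurable_id integral_id_gaussianReal
      rw [variance_id_gaussianReal, Real.coe_toNNReal _ (sq_nonneg σ)] at this
      simpa using this.symm
  -- The joint law is a product, so conditioning on the design becomes Fubini.
  have hpair (m : ℕ) : P.map (fun ω ↦ (x m ω, ε m ω)) =
      (P.map (x m)).prod (Measure.pi fun _ ↦ μ) := by
    rw [(indepFun_iff_map_prod_eq_prod_map_map (hx_meas m).aemeasurable (hεm m)).1
      (hindep_design m)]
    congr 1
    simpa only [hμε] using (hindep m).map_fun_eq_pi_map (hε m)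
  have hpm (m : ℕ) : AEMeasurable (fun ω ↦ (x m ω, ε m ω)) P :=
    (hx_meas m).aemeasurable.prodMk (hεm m)
  have hcomp (m : ℕ) : (fun ω ↦ standardizedError (Matrix.of (x m ω)) (y m ω) β) =
      (fun z : (Fin (n m) → Fin p → ℝ) × (Fin (n m) → ℝ) ↦
        standardizedError (Matrix.of z.1) (Matrix.of z.1 *ᵥ β + z.2) β) ∘
      fun ω ↦ (x m ω, ε m ω) := by
    funext ω
    rw [hmodel, Function.comp_apply]
  have hZ (m : ℕ) : AEMeasurable (fun ω ↦ standardizedError (Matrix.of (x m ω)) (y m ω) β) P := by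
    rw [hcomp]
    exact (measurable_standardizedError β).comp_aemeasurable (hpm m)
  have hlaw (m : ℕ) : P.map (fun ω ↦ standardizedError (Matrix.of (x m ω)) (y m ω) β) =
      ((P.map (x m)).prod (Measure.pi fun _ ↦ μ)).map
        fun z ↦ standardizedError (Matrix.of z.1) (Matrix.of z.1 *ᵥ β + z.2) β := by
    rw [← hpair m, hcomp, AEMeasurable.map_map_of_aemeasurable
      (measurable_standardizedError β).aemeasurable (hpm m)]
  refine ⟨hZ, aemeasurable_id, ?_⟩
  refine ProbabilityMeasure.tendsto_iff_tendsto_charFun.2 fun t ↦ ?_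
  have hlim : charFun (multivariateGaussian 0 (σ ^ 2 • (1 : Matrix (Fin p) (Fin p) ℝ))) t =
      Complex.exp (-(σ ^ 2 * ‖t‖ ^ 2 : ℝ) / 2) := by
    rw [charFun_multivariateGaussian (PosSemidef.one.smul (sq_nonneg σ))]
    have hnorm : ‖t‖ ^ 2 = t.ofLp ⬝ᵥ t.ofLp := by
      simp [EuclideanSpace.real_norm_sq_eq, dotProduct, ← sq]
    rw [smul_mulVec, one_mulVec, dotProduct_smul, ← hnorm, inner_zero_right, smul_eq_mul]
    congr 1
    push_cast
    ring
  simp only [ProbabilityMeasure.coe_mk, Measure.map_id, hlim, hlaw]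
  refine Metric.tendsto_nhds.2 fun r hr ↦ ?_
  have ht : 0 < ‖t‖ ^ 2 + 1 := by positivity
  -- The error r splits into r/2 from η‖t‖² and twice a probability below r/4; the +1 covers t = 0.
  obtain ⟨δ, hδ, hδn⟩ := exists_norm_prod_charFun_sub_exp_le hμL2 hμ0 hμ2
    (η := r / (2 * (‖t‖ ^ 2 + 1))) (by positivity)
  have hbad := (tendstoInMeasure_iff_measureReal_dist.1 hlev (δ / (‖t‖ ^ 2 + 1))
    (by positivity)).eventually_lt_const (show (0 : ℝ) < r / 4 by positivity)
  filter_upwards [hrank, hbad] with m hm hbm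
  have : IsProbabilityMeasure (P.map (x m)) :=
    Measure.isProbabilityMeasure_map (hx_meas m).aemeasurable
  have hbound := norm_charFun_standardizedError_sub_le β μ (P.map (x m))
    ((ae_map_iff (hx_meas m).aemeasurable measurableSet_rank_eq).2 hm) t (by positivity) (hδn (n m))
  have hle : (P.map (x m)).real {X | δ ≤ maxLeverage (Matrix.of X) * ‖t‖ ^ 2} ≤
      P.real {ω | δ / (‖t‖ ^ 2 + 1) ≤ dist (maxLeverage (Matrix.of (x m ω))) 0} := by
    rw [map_measureReal_apply (hx_meas m)
      (measurableSet_le measurable_const (measurable_maxLeverage.mul_const _))]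
    refine measureReal_mono fun ω hω ↦ ?_
    rw [Set.mem_ofPred_eq, Real.dist_0_eq_abs, div_le_iff₀ ht]
    have hω' : δ ≤ maxLeverage (Matrix.of (x m ω)) * ‖t‖ ^ 2 := hω
    have hpos : 0 < maxLeverage (Matrix.of (x m ω)) :=
      pos_of_mul_pos_left (hδ.trans_le hω') (by positivity)
    rw [abs_of_pos hpos]
    linarith
  have hη : r / (2 * (‖t‖ ^ 2 + 1)) * ‖t‖ ^ 2 ≤ r / 2 := by
    rw [div_mul_eq_mul_div, div_le_div_iff₀ (by positivity) two_pos]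
    nlinarith
  rw [dist_eq_norm]
  linarith
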